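/- Let $\mathbf{C}$ be a Markov category (a symmetric monoidal category in which every object carries a commutative comonoid structure $(\mathrm{copy},\mathrm{del})$ compatible with the tensor product, and whose monoidal unit $I$ is terminal) with conditionals: for every $f:A\to X\otimes Y$, with marginal $f_X:A\to X$, there is $f_{|X}:X\otimes A\to Y$ such that $f$ is obtained by copying $A$, applying $f_X$ to one copy, copying the resulting $X$, and applying $f_{|X}$ to one copy of $X$ and the remaining copy of $A$. For a state $p:I\to X$, morphisms $f,g:X\to Y$ are $p$-almost surely equal, $f\simeq_p g$, if $(\mathrm{id}_X\otimes f)\circ\mathrm{copy}_X\circ p=(\mathrm{id}_X\otimes g)\circ\mathrm{copy}_X\circ p$; and $f$ is $p$-almost surely deterministic if $\mathrm{copy}_Y\circ f\simeq_p (f\otimes f)\circ\mathrm{copy}_X$. Let $\mathbf{PS(C)}$ be the category whose objects are pairs $(X,p)$ of an object $X$ and a state $p:I\to X$ of $\mathbf{C}$, and whose morphisms $(X,p)\to(Y,q)$ are the morphisms $f:X\to Y$ of $\mathbf C$ with $f\circ p=q$, modulo $p$-almost sure equality. For $f:(X,p)\to(Y,q)$, let $f^\dagger:(Y,q)\to(X,p)$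 denote its Bayesian inverse, i.e. the (unique) morphism of $\mathbf{PS(C)}$ with $(f^\dagger\otimes \mathrm{id}_Y)\circ\mathrm{copy}_Y\circ q=(\mathrm{id}_X\otimes f)\circ\mathrm{copy}_X\circ p$. A dynamical system acting on $(X,p)$ is a functor $D$ from a monoid $M$ (seen as a one-object category) to $\mathbf{PS(C)}$ that maps the single object to $(X,p)$; write $m:(X,p)\to(X,p)$ for the action of $m\in M$, which need not be deterministic. A morphism $h$ into $(X,p)$ is left-invariant if $m\circ h=h$ in $\mathbf{PS(C)}$ for all $m\in M$. An invariant object of $D$ is a colimit $r:(X,p)\to(X_{\mathrm{inv}},p_{\mathrm{inv}})$ of $D$ in $\mathbf{PS(C)}$ such that, for every morphism $f$ out of $(X,p)$ with $f\circ m=f$ for all $m$, with factorization $f=\tilde f\circ r$, the morphism $f$ is almost surely deterministic if and only if $\tilde f$ is. A morphism $k:(A,b)\to(X,p)$ is almost surely ergodic if it is left-invariant and $r\circ k$ is $b$-almost surely deterministic. An ergodic decomposition of $g:(Y,q)\to(X,p)$ is a factorization $g=k\circ h$ in $\mathbf{PS(C)}$, with $h:(Y,q)\to(A,b)$, $k:(A,b)\to(X,p)$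 and $k$ almost surely ergodic. A reduction of a decomposition $(h,k)$ of $g$ through $(A,b)$ to a decomposition $(h',k')$ of $g$ through $(A',b')$ is an almost surely deterministic $d:(A,b)\to(A',b')$ with $k'\circ d=k$ and $d\circ h=h'$ in $\mathbf{PS(C)}$. Theorem. Suppose that every dynamical system in $\mathbf{PS(C)}$ (for every monoid) has an invariant object. Let $M$ be any monoid and $D:M\to\mathbf{PS(C)}$ a dynamical system acting on $(X,p)$, with invariant object $r:(X,p)\to(X_{\mathrm{inv}},p_{\mathrm{inv}})$. Then: 1. the morphism $r^\dagger:(X_{\mathrm{inv}},p_{\mathrm{inv}})\to(X,p)$ is almost surely ergodic; 2. every left-invariant morphism $g:(Y,q)\to(X,p)$ has an ergodic decomposition $g=r^\dagger\circ\tilde g$ for a unique $\tilde g:(Y,q)\to(X_{\mathrm{inv}},p_{\mathrm{inv}})$ of $\mathbf{PS(C)}$ (that is, unique up to $q$-almost sure equality); 3. for every left-invariant morphism $g:(Y,q)\to(X,p)$, every ergodic decomposition $(h,k)$ of $g$ has a unique reduction to the decomposition $(\tilde g,r^\dagger)$. -/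

import Mathlib

open CategoryTheory MonoidalCategory ComonObj CopyDiscardCategory

universe w v u

namespace ErgDec

section Markov

variable {C : Type u} [Category.{v} C] [MonoidalCategory C] [MarkovCategory C]

/-- `f` and `g` are `p`-almost surely equal: copying a `p`-distributed input and applying `f`,
respectively `g`, to one of the two copies gives the same joint state. -/
def AEEq {X Y : C} (p : 𝟙_ C ⟶ X) (f g : X ⟶ Y) : Prop :=
  p ≫ Δ[X] ≫ X ◁ f = p ≫ Δ[X] ≫ X ◁ g

/-- `f` is `p`-almost surely deterministic: it commutes with copying, `p`-almost surely. -/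
def AEDet {X Y : C} (p : 𝟙_ C ⟶ X) (f : X ⟶ Y) : Prop :=
  AEEq p (f ≫ Δ[Y]) (Δ[X] ≫ (f ⊗ₘ f))

variable (C) in
/-- Conditionals: every `f : A ⟶ X ⊗ Y` arises by copying `A`, producing `X` by the marginal of
`f`, copying `X`, and producing `Y` from `X` and `A` by a morphism `k : X ⊗ A ⟶ Y`. -/
class HasConditionals : Prop where
  exists_conditional {A X Y : C} (f : A ⟶ X ⊗ Y) : ∃ k : X ⊗ A ⟶ Y,
    f = Δ[A] ≫ (f ≫ X ◁ ε[Y] ≫ (ρ_ X).hom) ▷ A ≫ Δ[X] ▷ A ≫ (α_ X X A).hom ≫ X ◁ k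

variable (C) in
/-- Causality. -/
class IsCausal : Prop where
  causal {A W X Y : C} (f : A ⟶ W) (g : W ⟶ X) (h₁ h₂ : X ⟶ Y) :
    f ≫ g ≫ Δ[X] ≫ X ◁ h₁ = f ≫ g ≫ Δ[X] ≫ X ◁ h₂ →
    f ≫ Δ[W] ≫ W ◁ (g ≫ Δ[X] ≫ X ◁ h₁) = f ≫ Δ[W] ≫ W ◁ (g ≫ Δ[X] ≫ X ◁ h₂)

theorem copy_swap {X Y : C} (t : X ⟶ Y) :
    Δ[X] ≫ X ◁ t = Δ[X] ≫ t ▷ X ≫ (β_ Y X).hom := by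
  rw [BraidedCategory.braiding_naturality_left, IsCommComonObj.comul_comm_assoc]

theorem copy_graph {X Y : C} (h : X ⟶ Y) :
    Δ[X] ≫ (Δ[X] ≫ X ◁ h) ▷ X =
      (Δ[X] ≫ X ◁ h) ≫ Δ[X] ▷ Y ≫ (α_ X X Y).hom ≫ X ◁ (β_ X Y).hom ≫ (α_ X Y X).inv := by
  have e : (X ◁ h) ≫ Δ[X] ▷ Y = Δ[X] ▷ X ≫ (X ⊗ X) ◁ h := by rw [whisker_exchange]
  have e2 : Δ[X] ≫ Δ[X] ▷ X ≫ (α_ X X X).hom ≫ X ◁ (β_ X X).hom ≫ (α_ X X X).inv =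
      Δ[X] ≫ Δ[X] ▷ X := by
    have := ComonObj.comul_assoc X
    rw [← Category.assoc (Δ[X])] at this
    have h3 : Δ[X] ≫ Δ[X] ▷ X = Δ[X] ≫ X ◁ Δ[X] ≫ (α_ X X X).inv := by
      rw [← Category.assoc, this]; simp
    rw [reassoc_of% h3]
    simp only [Iso.inv_hom_id_assoc]
    rw [← whiskerLeft_comp_assoc, IsCommComonObj.comul_comm]
    exact h3.symm
  have e3 : (X ⊗ X) ◁ h ≫ (α_ X X Y).hom ≫ X ◁ (β_ X Y).hom ≫ (α_ X Y X).inv =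
      (α_ X X X).hom ≫ X ◁ (β_ X X).hom ≫ (α_ X X X).inv ≫ (X ◁ h) ▷ X := by
    have n : X ◁ h ≫ (β_ X Y).hom = (β_ X X).hom ≫ h ▷ X :=
      BraidedCategory.braiding_naturality_right X h
    have n' := congrArg (fun t => X ◁ t) n
    simp only [whiskerLeft_comp] at n'
    simp [reassoc_of% n']
  rw [Category.assoc, reassoc_of% e, e3, reassoc_of% e2, comp_whiskerRight]

instance [HasConditionals C] : IsCausal C where
  causal {A W X Y} f g h₁ h₂ H := by
    obtain ⟨k, hk⟩ := HasConditionals.exists_conditional (f ≫ Δ[W] ≫ g ▷ W)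
    have hm : (f ≫ Δ[W] ≫ g ▷ W) ≫ X ◁ ε[W] ≫ (ρ_ X).hom = f ≫ g := by
      simp only [Category.assoc, ← whisker_exchange_assoc, comul_counit_assoc]
      simp
    rw [hm] at hk
    have key : ∀ h : X ⟶ Y, f ≫ Δ[W] ≫ W ◁ (g ≫ Δ[X] ≫ X ◁ h) =
        Δ[A] ≫ ((f ≫ g ≫ Δ[X] ≫ X ◁ h) ≫ Δ[X] ▷ Y ≫ (α_ X X Y).hom ≫
          X ◁ (β_ X Y).hom ≫ (α_ X Y X).inv) ▷ A ≫ (α_ (X ⊗ Y) X A).hom ≫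
          (X ⊗ Y) ◁ k ≫ (β_ (X ⊗ Y) W).hom := by
      intro h
      have h4 := copy_graph h
      simp only [Category.assoc] at h4 ⊢
      rw [← h4, copy_swap]
      have h5 : f ≫ Δ[W] ≫ (g ≫ Δ[X] ≫ X ◁ h) ▷ W ≫ (β_ (X ⊗ Y) W).hom =
          (f ≫ Δ[W] ≫ g ▷ W) ≫ (Δ[X] ≫ X ◁ h) ▷ W ≫ (β_ (X ⊗ Y) W).hom := by simp
      rw [h5, hk]
      simp only [Category.assoc]
      rw [whisker_exchange_assoc]
      simp
    rw [key, key, H]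

theorem AEEq.comp [IsCausal C] {X Y Z : C} {p : 𝟙_ C ⟶ X} {f f' : X ⟶ Y} {g g' : Y ⟶ Z}
    (hf : AEEq p f f') (hg : AEEq (p ≫ f) g g') : AEEq p (f ≫ g) (f' ≫ g') := by
  have h1 := IsCausal.causal p f g g' (by simpa [AEEq] using hg)
  have h2 := h1 =≫ X ◁ (ε[Y] ▷ Z ≫ (λ_ Z).hom)
  have e : ∀ g : Y ⟶ Z, (f ≫ Δ[Y] ≫ Y ◁ g) ≫ ε[Y] ▷ Z ≫ (λ_ Z).hom = f ≫ g := by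
    intro g
    simp only [Category.assoc, whisker_exchange_assoc, counit_comul_assoc]
    simp
  simp only [Category.assoc, ← whiskerLeft_comp] at h2
  simp only [Category.assoc] at e
  rw [e, e] at h2
  have h3 := hf =≫ X ◁ g'
  simp only [Category.assoc, ← whiskerLeft_comp] at h3
  exact h2.trans h3

theorem AEEq.tensor_copy {X Y : C} {p : 𝟙_ C ⟶ X} {f f' : X ⟶ Y}
    (hf : AEEq p f f') : AEEq p (Δ[X] ≫ (f ⊗ₘ f)) (Δ[X] ≫ (f' ⊗ₘ f')) := by
  have a : ∀ s t : X ⟶ Y, Δ[X] ≫ X ◁ (Δ[X] ≫ (s ⊗ₘ t)) =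
      (Δ[X] ≫ X ◁ t) ≫ Δ[X] ▷ Y ≫ (X ◁ s) ▷ Y ≫ (α_ X Y Y).hom := by
    intro s t
    rw [MonoidalCategory.tensorHom_def]
    simp only [whiskerLeft_comp, Category.assoc, comul_assoc_assoc, whisker_exchange_assoc]
    simp
  have b : ∀ s t : X ⟶ Y, Δ[X] ≫ X ◁ (Δ[X] ≫ (s ⊗ₘ t)) =
      (Δ[X] ≫ X ◁ (Δ[X] ≫ (t ⊗ₘ s))) ≫ X ◁ (β_ Y Y).hom := by
    intro s t
    rw [Category.assoc, ← whiskerLeft_comp, Category.assoc, BraidedCategory.braiding_naturality,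
      IsCommComonObj.comul_comm_assoc]
  have c : ∀ s t t' : X ⟶ Y, AEEq p t t' → AEEq p (Δ[X] ≫ (s ⊗ₘ t)) (Δ[X] ≫ (s ⊗ₘ t')) := by
    intro s t t' h
    have := h =≫ (Δ[X] ▷ Y ≫ (X ◁ s) ▷ Y ≫ (α_ X Y Y).hom)
    simp only [Category.assoc] at this
    simp only [AEEq, a, Category.assoc]
    exact this
  refine (c f f f' hf).trans ?_
  have := (c f' f f' hf) =≫ X ◁ (β_ Y Y).hom
  rw [b f f', b f' f']
  simpa only [Category.assoc] using this

theorem AEDet.congr {X Y : C} {p : 𝟙_ C ⟶ X} {f f' : X ⟶ Y}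
    (hf : AEEq p f f') (h : AEDet p f) : AEDet p f' := by
  have h1 : AEEq p (f ≫ Δ[Y]) (f' ≫ Δ[Y]) := by
    have := hf =≫ X ◁ Δ[Y]
    simpa [AEEq] using this
  exact (h1.symm.trans h).trans hf.tensor_copy

end Markov

/-- Probability spaces in a Markov category: an object together with a state on it. -/
structure PS (C : Type u) [Category.{v} C] [MonoidalCategory C] where
  carrier : C
  state : 𝟙_ C ⟶ carrier

namespace PS

variable {C : Type u} [Category.{v} C] [MonoidalCategory C] [MarkovCategory C]

/-- State-preserving morphisms. -/
def PreHom (P Q : PS C) : Type v :=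
  {f : P.carrier ⟶ Q.carrier // P.state ≫ f = Q.state}

/-- Almost sure equality of state-preserving morphisms. -/
instance homSetoid (P Q : PS C) : Setoid (PreHom P Q) where
  r f g := AEEq P.state f.1 g.1
  iseqv := ⟨fun _ => rfl, fun h => Eq.symm h, fun h h' => Eq.trans h h'⟩

/-- The category of probability spaces in `C`: morphisms are the state-preserving morphisms of `C`
modulo almost sure equality. -/
instance category [IsCausal C] : Category.{v} (PS C) where
  Hom P Q := Quotient (homSetoid P Q)
  id P := Quotient.mk _ ⟨𝟙 P.carrier, Category.comp_id _⟩
  comp {P Q R} f g := Quotient.map₂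
    (fun (f : PreHom P Q) (g : PreHom Q R) =>
      (⟨f.1 ≫ g.1, by rw [← Category.assoc, f.2, g.2]⟩ : PreHom P R))
    (fun f f' hf g g' hg => by
      refine AEEq.comp (C := C) hf ?_
      rw [f.2]
      exact hg) f g
  id_comp f := by
    induction f using Quotient.inductionOn with
    | h f => exact congrArg (Quotient.mk _) (Subtype.ext (Category.id_comp _))
  comp_id f := by
    induction f using Quotient.inductionOn with
    | h f => exact congrArg (Quotient.mk _) (Subtype.ext (Category.comp_id _))
  assoc f g h := by
    induction f using Quotient.inductionOn with
    | h f =>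
      induction g using Quotient.inductionOn with
      | h g =>
        induction h using Quotient.inductionOn with
        | h h => exact congrArg (Quotient.mk _) (Subtype.ext (Category.assoc _ _ _))

variable [IsCausal C]

/-- Almost sure determinism of a morphism of `PS C`. -/
def IsDet {P Q : PS C} (f : P ⟶ Q) : Prop :=
  Quotient.liftOn (s := homSetoid P Q) f (fun f₀ => AEDet P.state f₀.1) fun _ _ h =>
    propext ⟨AEDet.congr h, AEDet.congr (Eq.symm h)⟩

/-- The joint state on `P ⊗ Q` obtained by copying the state of `P` and applying `f` to one of the
two copies. -/
def joint {P Q : PS C} (f : P ⟶ Q) : 𝟙_ C ⟶ P.carrier ⊗ Q.carrier :=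
  Quotient.liftOn (s := homSetoid P Q) f
    (fun f₀ => P.state ≫ Δ[P.carrier] ≫ P.carrier ◁ f₀.1) fun _ _ h => h

/-- `g` is a Bayesian inverse of `f`: the two have the same joint state, up to swapping. -/
def IsBayesianInverse {P Q : PS C} (f : P ⟶ Q) (g : Q ⟶ P) : Prop :=
  joint g ≫ (β_ Q.carrier P.carrier).hom = joint f

theorem joint_injective {P Q : PS C} {f g : P ⟶ Q} (h : joint f = joint g) : f = g := by
  induction f using Quotient.inductionOn with
  | h f =>
    induction g using Quotient.inductionOn with
    | h g => exact Quotient.sound h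

theorem IsBayesianInverse.unique {P Q : PS C} {f : P ⟶ Q} {g g' : Q ⟶ P}
    (h : IsBayesianInverse f g) (h' : IsBayesianInverse f g') : g = g' := by
  apply joint_injective
  have := Eq.trans h (Eq.symm h')
  exact (cancel_mono _).1 this

theorem exists_isBayesianInverse [HasConditionals C] {P Q : PS C} (f : P ⟶ Q) :
    ∃ g : Q ⟶ P, IsBayesianInverse f g := by
  induction f using Quotient.inductionOn with
  | h f =>
    obtain ⟨X, p⟩ := P
    obtain ⟨Y, q⟩ := Q
    obtain ⟨f, hf⟩ := f
    dsimp at f hf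
    obtain ⟨k, hk⟩ := HasConditionals.exists_conditional (p ≫ Δ[X] ≫ f ▷ X)
    have hm : (p ≫ Δ[X] ≫ f ▷ X) ≫ Y ◁ ε[X] ≫ (ρ_ Y).hom = q := by
      simp only [Category.assoc, ← whisker_exchange_assoc, comul_counit_assoc]
      simpa using hf
    rw [hm, copy_unit] at hk
    have h1 : p ≫ Δ[X] ≫ f ▷ X = q ≫ Δ[Y] ≫ Y ◁ ((ρ_ Y).inv ≫ k) := by
      rw [hk]
      simp [unitors_inv_equal]
    have h2 : q ≫ (ρ_ Y).inv ≫ k = p := by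
      have := h1 =≫ (ε[Y] ▷ X ≫ (λ_ X).hom)
      simp only [Category.assoc, whisker_exchange_assoc, counit_comul_assoc] at this
      rw [leftUnitor_naturality, Iso.inv_hom_id_assoc] at this
      rw [← comp_whiskerRight_assoc, MarkovCategory.discard_natural, counit_comul_assoc] at this
      simpa using this.symm
    refine ⟨Quotient.mk _ ⟨(ρ_ Y).inv ≫ k, h2⟩, ?_⟩
    change (q ≫ Δ[Y] ≫ Y ◁ ((ρ_ Y).inv ≫ k)) ≫ (β_ Y X).hom = p ≫ Δ[X] ≫ X ◁ f
    rw [← h1, copy_swap]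
    simp

/-- The dagger of `PS C`: the Bayesian inverse. -/
noncomputable def dagger [HasConditionals C] {P Q : PS C} (f : P ⟶ Q) : Q ⟶ P :=
  (exists_isBayesianInverse f).choose

theorem dagger_isBayesianInverse [HasConditionals C] {P Q : PS C} (f : P ⟶ Q) :
    IsBayesianInverse f (dagger f) :=
  (exists_isBayesianInverse f).choose_spec

end PS

section Dynamics

variable {C : Type u} [Category.{v} C] [MonoidalCategory C] [MarkovCategory C] [IsCausal C]

/-- A dynamical system in `PS C` with monoid `M`: a functor from the one-object category of `M`.
An element `m` acts as `D.map m`. -/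
abbrev DynSystem (C : Type u) [Category.{v} C] [MonoidalCategory C] [MarkovCategory C]
    [IsCausal C] (M : Type w) [Monoid M] :=
  SingleObj M ⥤ PS C

variable {M : Type w} [Monoid M]

namespace DynSystem

/-- The probability space acted upon. -/
abbrev space (D : DynSystem C M) : PS C := D.obj (SingleObj.star M)

/-- The morphism by which `m : M` acts. -/
abbrev act (D : DynSystem C M) (m : M) : D.space ⟶ D.space :=
  D.map (SingleObj.toEnd M m)

/-- `h` is left-invariant: `m ∘ h = h` for all `m`. -/
def LeftInvariant (D : DynSystem C M) {A : PS C} (h : A ⟶ D.space) : Prop :=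
  ∀ m : M, h ≫ D.act m = h

/-- The single leg of a cocone over a dynamical system. -/
abbrev leg {D : DynSystem C M} (c : Limits.Cocone D) : D.space ⟶ c.pt :=
  c.ι.app (SingleObj.star M)

/-- `c` is an invariant object of `D`: a colimit of `D`, such that an invariant morphism is almost
surely deterministic iff its factorization through the colimit is. -/
structure IsInvariantObject {D : DynSystem C M} (c : Limits.Cocone D) : Prop where
  isColimit : Nonempty (Limits.IsColimit c)
  det_iff : ∀ (s : Limits.Cocone D) (f : c.pt ⟶ s.pt), leg c ≫ f = leg s →
    (PS.IsDet (leg s) ↔ PS.IsDet f)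

end DynSystem

variable (C) in
/-- All invariant objects of `PS C` exist (for monoids in the universe `w`). -/
def HasInvariantObjects : Prop :=
  ∀ (M : Type w) [Monoid M] (D : DynSystem C M),
    ∃ c : Limits.Cocone D, DynSystem.IsInvariantObject c

/-- `k : A ⟶ (X, p)` is almost surely ergodic for `D`, with respect to the invariant object `c`. -/
structure IsErgodic {D : DynSystem C M} (c : Limits.Cocone D) {A : PS C} (k : A ⟶ D.space) :
    Prop where
  det : PS.IsDet (k ≫ DynSystem.leg c)
  leftInvariant : D.LeftInvariant k

/-- A decomposition of `f`: a factorization through some probability space. -/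
structure Decomposition {P Q : PS C} (f : P ⟶ Q) where
  mid : PS C
  fst : P ⟶ mid
  snd : mid ⟶ Q
  fac : fst ≫ snd = f

/-- `d` exhibits `E'` as a reduction of `E`. -/
structure Decomposition.IsReduction {P Q : PS C} {f : P ⟶ Q} (E E' : Decomposition f)
    (d : E.mid ⟶ E'.mid) : Prop where
  det : PS.IsDet d
  snd_eq : d ≫ E'.snd = E.snd
  fst_eq : E.fst ≫ d = E'.fst

/-- An ergodic decomposition: the second factor is almost surely ergodic. -/
def Decomposition.Ergodic {D : DynSystem C M} (c : Limits.Cocone D) {P : PS C}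
    {g : P ⟶ D.space} (E : Decomposition g) : Prop :=
  IsErgodic c E.snd

end Dynamics

end ErgDec

/-! Write `r` for the leg of the invariant object. The identity factors `r` through itself, so `r`
is almost surely deterministic and `r† ≫ r = 𝟙`. The main tool is `isBayesianInverse_of_comp_eq_id`:
a morphism of `PS C` with a retraction has that retraction as its Bayesian inverse. If `m ≫ r = r`,
then `r† ≫ m† = r†`, so `m† ≫ r` is a retraction of `r†` and must equal `r†† = r`
(`IsDet.dagger_comp_eq`). Taking daggers, `r† ≫ m = r†`, so `r†` is left-invariant.

For a left-invariant `g`, the morphism `g†` is invariant under every `m†`, so it factors through the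
invariant object `r'` of the reversed system. By the same tool `r'` is invariant under every `m`,
hence factors through `r`. So `g† = r ≫ t`, that is `g = t† ≫ r†`, and `r† ≫ r = 𝟙` forces `t† = g ≫
r`. Uniqueness of decompositions and of reductions is cancellation of the split mono `r†`. -/

namespace ErgDec

/-! ### Copying and conditionals in a Markov category. -/

section Markov

variable {C : Type u} [Category.{v} C] [MonoidalCategory C] [MarkovCategory C]

theorem copy_comp_copy_tensor_copy (X : C) :
    Δ[X] ≫ (Δ[X] ⊗ₘ Δ[X]) =
      Δ[X] ≫ X ◁ Δ[X] ≫ X ◁ Δ[X] ▷ X ≫ X ◁ (α_ X X X).hom ≫ (α_ X X (X ⊗ X)).inv := by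
  rw [← cancel_mono (α_ X X (X ⊗ X)).hom]
  simp only [MonoidalCategory.tensorHom_def, Category.assoc, Iso.inv_hom_id, Category.comp_id,
    ← whiskerLeft_comp, ← comul_assoc]
  rw [associator_naturality_right, ← comul_assoc_assoc, whiskerLeft_comp]

/-- Copying is deterministic. -/
theorem copy_comp_copy (X : C) :
    Δ[X] ≫ (comonObj (X ⊗ X)).comul = Δ[X] ≫ (Δ[X] ⊗ₘ Δ[X]) := by
  -- The copy of a tensor product swaps the two middle outputs; both come from one copy, so
  -- commutativity absorbs the swap.
  have h : X ◁ Δ[X] ▷ X ≫ X ◁ (β_ X X).hom ▷ X = X ◁ Δ[X] ▷ X := by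
    rw [← whiskerLeft_comp, ← comp_whiskerRight, IsCommComonObj.comul_comm]
  rw [copy_tensor, tensorμ, reassoc_of% (copy_comp_copy_tensor_copy X),
    copy_comp_copy_tensor_copy X]
  simp only [Iso.inv_hom_id_assoc, ← whiskerLeft_comp_assoc, Iso.hom_inv_id_assoc]
  simp only [whiskerLeft_comp, Category.assoc, reassoc_of% h]

/-- Every joint state is generated by its first marginal. -/
theorem exists_state_conditional [HasConditionals C] {X Y : C} (s : 𝟙_ C ⟶ X ⊗ Y) :
    ∃ k : X ⟶ Y, s = (s ≫ X ◁ ε[Y] ≫ (ρ_ X).hom) ≫ Δ[X] ≫ X ◁ k := by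
  obtain ⟨k, hk⟩ := HasConditionals.exists_conditional s
  refine ⟨(ρ_ X).inv ≫ k, ?_⟩
  generalize s ≫ X ◁ ε[Y] ≫ (ρ_ X).hom = q at hk
  rw [hk, copy_unit]
  simp [unitors_inv_equal]

/-- If the first two outputs of a joint state are almost surely equal, they may be swapped. -/
theorem swap_of_marginal_eq_copy [HasConditionals C] {X Y : C} {p : 𝟙_ C ⟶ X}
    {s : 𝟙_ C ⟶ (X ⊗ X) ⊗ Y} (hs : s ≫ (X ⊗ X) ◁ ε[Y] ≫ (ρ_ (X ⊗ X)).hom = p ≫ Δ[X]) :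
    s ≫ (β_ X X).hom ▷ Y = s := by
  obtain ⟨k, hk⟩ := exists_state_conditional s
  -- Copying a duplicated pair yields two separate duplicated pairs: one is output, where the swap
  -- is absorbed, and one feeds `k`.
  rw [hs, Category.assoc, reassoc_of% (copy_comp_copy X)] at hk
  rw [hk, Category.assoc, Category.assoc, Category.assoc, whisker_exchange,
    MonoidalCategory.tensorHom_def']
  simp only [Category.assoc]
  rw [← comp_whiskerRight_assoc, IsCommComonObj.comul_comm]

end Markov

/-! ### Bayesian inverses and determinism in `PS C`. -/

namespace PS

variable {C : Type u} [Category.{v} C] [MonoidalCategory C] [MarkovCategory C]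

section Causal

variable [IsCausal C]

/-- The class of a state-preserving morphism. -/
def homMk {P Q : PS C} (f : P.carrier ⟶ Q.carrier) (h : P.state ≫ f = Q.state) : P ⟶ Q :=
  Quotient.mk (homSetoid P Q) ⟨f, h⟩

theorem exists_homMk {P Q : PS C} (f : P ⟶ Q) : ∃ f₀ h, f = homMk f₀ h := by
  induction f using Quotient.inductionOn with
  | h f => exact ⟨f.1, f.2, rfl⟩

theorem joint_homMk {P Q : PS C} (f : P.carrier ⟶ Q.carrier) (h : P.state ≫ f = Q.state) :
    joint (homMk f h) = P.state ≫ Δ[P.carrier] ≫ P.carrier ◁ f := rfl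

theorem joint_homMk_braiding {P Q : PS C} (f : P.carrier ⟶ Q.carrier)
    (h : P.state ≫ f = Q.state) :
    joint (homMk f h) ≫ (β_ P.carrier Q.carrier).hom =
      P.state ≫ Δ[P.carrier] ≫ f ▷ P.carrier := by
  rw [joint_homMk, copy_swap]
  simp

theorem joint_id (P : PS C) : joint (𝟙 P) = P.state ≫ Δ[P.carrier] := by
  change P.state ≫ Δ[P.carrier] ≫ P.carrier ◁ 𝟙 _ = _
  simp

theorem joint_comp_homMk {P Q R : PS C} (f : P ⟶ Q) (g : Q.carrier ⟶ R.carrier)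
    (h : Q.state ≫ g = R.state) : joint (f ≫ homMk g h) = joint f ≫ P.carrier ◁ g := by
  obtain ⟨f, hf, rfl⟩ := exists_homMk f
  change P.state ≫ Δ[P.carrier] ≫ P.carrier ◁ (f ≫ g) = _
  simp [joint_homMk]

theorem isDet_id (P : PS C) : IsDet (𝟙 P) := by
  change AEEq P.state (𝟙 _ ≫ Δ[P.carrier]) (Δ[P.carrier] ≫ (𝟙 _ ⊗ₘ 𝟙 _))
  simp [AEEq]

theorem IsDet.state_copy {P Q : PS C} {f : P.carrier ⟶ Q.carrier} {h : P.state ≫ f = Q.state}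
    (hf : IsDet (homMk f h)) :
    P.state ≫ Δ[P.carrier] ≫ (f ⊗ₘ f) = Q.state ≫ Δ[Q.carrier] := by
  have H : AEEq P.state (f ≫ Δ[Q.carrier]) (Δ[P.carrier] ≫ (f ⊗ₘ f)) := hf
  have e : ∀ {Z : C} (g : P.carrier ⟶ Z), (P.state ≫ Δ[P.carrier] ≫ P.carrier ◁ g) ≫
      ε[P.carrier] ▷ Z ≫ (λ_ Z).hom = P.state ≫ g := by
    intro Z g
    simp only [Category.assoc, whisker_exchange_assoc, counit_comul_assoc]
    simp
  -- Discarding the reference copy turns almost sure equality into equality of output states.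
  have H' := H =≫ (ε[P.carrier] ▷ _ ≫ (λ_ _).hom)
  rw [e, e, reassoc_of% h] at H'
  exact H'.symm

theorem IsBayesianInverse.symm {P Q : PS C} {f : P ⟶ Q} {g : Q ⟶ P}
    (h : IsBayesianInverse f g) : IsBayesianInverse g f := by
  unfold IsBayesianInverse at *
  rw [← h, Category.assoc, SymmetricCategory.symmetry, Category.comp_id]

theorem IsBayesianInverse.id (P : PS C) : IsBayesianInverse (𝟙 P) (𝟙 P) := by
  simp [IsBayesianInverse, joint_id]

/-- Both joint states arise by copying the state of the middle space `Q` and applying `f'` to one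
copy and `g` to the other. -/
theorem IsBayesianInverse.comp {P Q R : PS C} {f : P ⟶ Q} {f' : Q ⟶ P} {g : Q ⟶ R} {g' : R ⟶ Q}
    (hf : IsBayesianInverse f f') (hg : IsBayesianInverse g g') :
    IsBayesianInverse (f ≫ g) (g' ≫ f') := by
  have hg' := hg.symm
  unfold IsBayesianInverse at *
  obtain ⟨f', hf', rfl⟩ := exists_homMk f'
  obtain ⟨g, hg₀, rfl⟩ := exists_homMk g
  rw [joint_homMk_braiding] at hf
  rw [joint_comp_homMk, joint_comp_homMk, ← hf, ← hg', joint_homMk]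
  simp only [Category.assoc, ← BraidedCategory.braiding_naturality_left,
    SymmetricCategory.symmetry, Category.comp_id]
  rw [whisker_exchange]

/-- A Bayesian inverse of an almost surely deterministic morphism is a section of it. -/
theorem IsBayesianInverse.comp_eq_id {P Q : PS C} {f : P ⟶ Q} {g : Q ⟶ P}
    (h : IsBayesianInverse f g) (hf : IsDet f) : g ≫ f = 𝟙 Q := by
  apply joint_injective
  have h' := h.symm
  unfold IsBayesianInverse at h'
  obtain ⟨f, hf₀, rfl⟩ := exists_homMk f
  -- The joint state of `g ≫ f` becomes `f ⊗ f` applied to a copied `P`-state, which determinism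
  -- identifies with the copied `Q`-state.
  rw [joint_comp_homMk, ← h', joint_homMk_braiding, joint_id, ← hf.state_copy,
    MonoidalCategory.tensorHom_def]
  simp only [Category.assoc]

end Causal

variable [HasConditionals C]

/-- A section is a Bayesian inverse of its retraction. -/
theorem isBayesianInverse_of_comp_eq_id {P Q : PS C} {f : P ⟶ Q} {g : Q ⟶ P}
    (h : f ≫ g = 𝟙 P) : IsBayesianInverse f g := by
  obtain ⟨f, hf, rfl⟩ := exists_homMk f
  obtain ⟨g, hg, rfl⟩ := exists_homMk g
  have hj := congrArg joint h
  rw [joint_comp_homMk, joint_homMk, joint_id] at hj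
  unfold IsBayesianInverse
  rw [joint_homMk_braiding, joint_homMk]
  obtain ⟨X, p⟩ := P
  obtain ⟨Y, q⟩ := Q
  dsimp only at *
  -- The joint law of `(x, g y, y)` with `y` drawn from `f x`; since `f ≫ g = 𝟙`, its first two
  -- components agree almost surely and may be swapped.
  have hs : (p ≫ Δ[X] ≫ X ◁ (f ≫ Δ[Y] ≫ g ▷ Y) ≫ (α_ X X Y).inv) ≫
      (X ⊗ X) ◁ ε[Y] ≫ (ρ_ (X ⊗ X)).hom = p ≫ Δ[X] := by
    have e : (Δ[Y] ≫ g ▷ Y) ≫ X ◁ ε[Y] ≫ (ρ_ X).hom = g := by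
      simp only [Category.assoc, ← whisker_exchange_assoc, comul_counit_assoc]
      simp
    rw [← hj]
    simp only [Category.assoc] at e ⊢
    have e' : (α_ X X Y).inv ≫ (X ⊗ X) ◁ ε[Y] ≫ (ρ_ (X ⊗ X)).hom =
        X ◁ (X ◁ ε[Y] ≫ (ρ_ X).hom) := by simp
    rw [e', ← whiskerLeft_comp, ← whiskerLeft_comp]
    simp only [Category.assoc, e]
  have hβ : (β_ X X).hom ≫ ε[X] ▷ X ≫ (λ_ X).hom = X ◁ ε[X] ≫ (ρ_ X).hom := by
    rw [← BraidedCategory.braiding_naturality_right_assoc]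
    simp
  -- Swapping and then dropping the first component drops the second. Thus `(x, y)` and `(g y, y)`
  -- have the same law, which is the Bayesian inverse equation.
  have key := swap_of_marginal_eq_copy hs =≫ ((ε[X] ▷ X ≫ (λ_ X).hom) ▷ Y)
  rw [Category.assoc, ← comp_whiskerRight, hβ] at key
  have l : (p ≫ Δ[X] ≫ X ◁ (f ≫ Δ[Y] ≫ g ▷ Y) ≫ (α_ X X Y).inv) ≫
      (X ◁ ε[X] ≫ (ρ_ X).hom) ▷ Y = p ≫ Δ[X] ≫ X ◁ f := by
    have e : (Δ[Y] ≫ g ▷ Y) ≫ ε[X] ▷ Y ≫ (λ_ Y).hom = 𝟙 Y := by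
      rw [Category.assoc, ← comp_whiskerRight_assoc, MarkovCategory.discard_natural,
        counit_comul_assoc, Iso.inv_hom_id]
    have e' := congrArg (fun t => X ◁ t) e
    simp only [whiskerLeft_comp, Category.assoc, whiskerLeft_id] at e'
    simp [e']
  have r : (p ≫ Δ[X] ≫ X ◁ (f ≫ Δ[Y] ≫ g ▷ Y) ≫ (α_ X X Y).inv) ≫
      (ε[X] ▷ X ≫ (λ_ X).hom) ▷ Y = q ≫ Δ[Y] ≫ g ▷ Y := by
    have e : (α_ X X Y).inv ≫ (ε[X] ▷ X ≫ (λ_ X).hom) ▷ Y =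
        ε[X] ▷ (X ⊗ Y) ≫ (λ_ (X ⊗ Y)).hom := by simp
    simp only [Category.assoc]
    rw [e, whisker_exchange_assoc, counit_comul_assoc]
    simp [reassoc_of% hf]
  rw [← r, ← key, l]

theorem dagger_eq {P Q : PS C} {f : P ⟶ Q} {g : Q ⟶ P} (h : IsBayesianInverse f g) :
    dagger f = g :=
  (dagger_isBayesianInverse f).unique h

theorem dagger_dagger {P Q : PS C} (f : P ⟶ Q) : dagger (dagger f) = f :=
  dagger_eq (dagger_isBayesianInverse f).symm

theorem dagger_id (P : PS C) : dagger (𝟙 P) = 𝟙 P :=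
  dagger_eq (.id P)

theorem dagger_comp {P Q R : PS C} (f : P ⟶ Q) (g : Q ⟶ R) :
    dagger (f ≫ g) = dagger g ≫ dagger f :=
  dagger_eq ((dagger_isBayesianInverse f).comp (dagger_isBayesianInverse g))

theorem IsDet.dagger_comp_self {P Q : PS C} {f : P ⟶ Q} (hf : IsDet f) :
    dagger f ≫ f = 𝟙 Q :=
  (dagger_isBayesianInverse f).comp_eq_id hf

/-- An almost surely deterministic observable invariant under `m` is invariant under `m†`. -/
theorem IsDet.dagger_comp_eq {P Q : PS C} {r : P ⟶ Q} (hr : IsDet r) {m : P ⟶ P}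
    (hm : m ≫ r = r) : dagger m ≫ r = r := by
  -- Makes `dagger m ≫ r` a retraction of `dagger r`, hence its Bayesian inverse; but so is `r`.
  have h : dagger r ≫ dagger m ≫ r = 𝟙 Q := by
    rw [← Category.assoc, ← dagger_comp, hm, hr.dagger_comp_self]
  rw [← dagger_eq (isBayesianInverse_of_comp_eq_id h), dagger_dagger]

end PS

/-! ### Invariant objects and the reversed system. -/

namespace DynSystem

variable {C : Type u} [Category.{v} C] [MonoidalCategory C] [MarkovCategory C]
variable {M : Type w} [Monoid M]

section Causal

variable [IsCausal C]

/-- The cocone given by an invariant morphism. -/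
def coconeOfInvariant (D : DynSystem C M) {A : PS C} (f : D.space ⟶ A)
    (hf : ∀ m : M, D.act m ≫ f = f) : Limits.Cocone D where
  pt := A
  ι :=
    { app := fun _ => f
      naturality := fun _ _ m => (hf m).trans (Category.comp_id f).symm }

theorem act_comp_leg {D : DynSystem C M} (c : Limits.Cocone D) (m : M) :
    D.act m ≫ leg c = leg c :=
  c.w (SingleObj.toEnd M m)

theorem IsInvariantObject.isDet_leg {D : DynSystem C M} {c : Limits.Cocone D}
    (hc : IsInvariantObject c) : PS.IsDet (leg c) :=
  (hc.det_iff c (𝟙 _) (Category.comp_id _)).2 (PS.isDet_id _)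

theorem IsInvariantObject.exists_leg_comp_eq {D : DynSystem C M} {c : Limits.Cocone D}
    (hc : IsInvariantObject c) {A : PS C} (f : D.space ⟶ A) (hf : ∀ m : M, D.act m ≫ f = f) :
    ∃ t : c.pt ⟶ A, leg c ≫ t = f :=
  let ⟨h⟩ := hc.isColimit
  ⟨h.desc (D.coconeOfInvariant f hf), h.fac _ _⟩

end Causal

variable [HasConditionals C]

/-- The reversed dynamical system, in which `m` acts by the Bayesian inverse of its action. -/
noncomputable def reverse (D : DynSystem C M) : DynSystem C Mᵐᵒᵖ where
  obj _ := D.space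
  map {_ _} (m : Mᵐᵒᵖ) := PS.dagger (D.act m.unop)
  map_id _ := (congrArg PS.dagger (D.map_id (SingleObj.star M))).trans (PS.dagger_id _)
  -- Composition in `SingleObj` multiplies in reverse order, so `m ≫ n` is `n * m`, whose `unop`
  -- acts as `n.unop` followed by `m.unop`.
  map_comp {_ _ _} (m n : Mᵐᵒᵖ) :=
    (congrArg PS.dagger (D.map_comp (SingleObj.toEnd M n.unop) (SingleObj.toEnd M m.unop))).trans
      (PS.dagger_comp _ _)

variable {D : DynSystem C M} {c : Limits.Cocone D}

theorem IsInvariantObject.leftInvariant_dagger_leg (hc : IsInvariantObject c) :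
    D.LeftInvariant (PS.dagger (leg c)) := by
  intro m
  have h := congrArg PS.dagger (hc.isDet_leg.dagger_comp_eq (act_comp_leg c m))
  rwa [PS.dagger_comp, PS.dagger_dagger] at h

/-- A morphism invariant under all `m†` factors through the invariant object. -/
theorem IsInvariantObject.exists_leg_comp_eq_of_dagger (hC : HasInvariantObjects.{w} C)
    (hc : IsInvariantObject c) {A : PS C} (f : D.space ⟶ A)
    (hf : ∀ m : M, PS.dagger (D.act m) ≫ f = f) : ∃ t : c.pt ⟶ A, leg c ≫ t = f := by
  obtain ⟨c', hc'⟩ := hC Mᵐᵒᵖ D.reverse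
  let r : D.space ⟶ c'.pt := leg c'
  have hdet : PS.IsDet r := hc'.isDet_leg
  have hinv (m : M) : PS.dagger (D.act m) ≫ r = r := act_comp_leg c' (MulOpposite.op m)
  obtain ⟨t, ht⟩ : ∃ t, r ≫ t = f := hc'.exists_leg_comp_eq f fun m => hf m.unop
  -- Invariance passes back from `m†` to `m†† = m` because `r` is almost surely deterministic.
  obtain ⟨u, hu⟩ := hc.exists_leg_comp_eq r fun m => by
    have h := hdet.dagger_comp_eq (hinv m)
    rwa [PS.dagger_dagger] at h
  exact ⟨u ≫ t, by rw [← Category.assoc, hu, ht]⟩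

/-- Averaging over the invariant object fixes every left-invariant morphism. -/
theorem IsInvariantObject.comp_leg_comp_dagger (hC : HasInvariantObjects.{w} C)
    (hc : IsInvariantObject c) {Y : PS C} {g : Y ⟶ D.space} (hg : D.LeftInvariant g) :
    (g ≫ leg c) ≫ PS.dagger (leg c) = g := by
  obtain ⟨t, ht⟩ := hc.exists_leg_comp_eq_of_dagger hC (PS.dagger g) fun m => by
    rw [← PS.dagger_comp, hg m]
  have h : g = PS.dagger t ≫ PS.dagger (leg c) := by
    rw [← PS.dagger_comp, ht, PS.dagger_dagger]
  rw [h, Category.assoc (PS.dagger t), hc.isDet_leg.dagger_comp_self, Category.comp_id]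

/-- The leg retracts its dagger; this gives uniqueness both of the decomposition and of the
reduction. -/
theorem IsInvariantObject.eq_comp_leg (hc : IsInvariantObject c) {Y : PS C} {g : Y ⟶ D.space}
    {t : Y ⟶ c.pt} (h : t ≫ PS.dagger (leg c) = g) : t = g ≫ leg c := by
  rw [← h, Category.assoc, hc.isDet_leg.dagger_comp_self, Category.comp_id]

theorem IsInvariantObject.isErgodic_dagger_leg (hc : IsInvariantObject c) :
    IsErgodic c (PS.dagger (leg c)) where
  det := by
    rw [hc.isDet_leg.dagger_comp_self]
    exact PS.isDet_id _
  leftInvariant := hc.leftInvariant_dagger_leg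

end DynSystem

end ErgDec

theorem mainTheorem3 {C : Type u} [Category.{v} C] [MonoidalCategory C] [MarkovCategory C]
    [ErgDec.HasConditionals C] (hC : ErgDec.HasInvariantObjects.{w} C)
    {M : Type w} [Monoid M] (D : ErgDec.DynSystem C M)
    (c : Limits.Cocone D) (hc : ErgDec.DynSystem.IsInvariantObject c) :
    -- the dagger of `r : (X, p) ⟶ (X_inv, p_inv)` is almost surely ergodic
    ErgDec.IsErgodic c (ErgDec.PS.dagger (ErgDec.DynSystem.leg c)) ∧
    -- every left-invariant morphism decomposes uniquely, and ergodically, through it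
    (∀ {Y : ErgDec.PS C} (g : Y ⟶ D.space), D.LeftInvariant g →
      ∃! gt : Y ⟶ c.pt, ∃ h : gt ≫ ErgDec.PS.dagger (ErgDec.DynSystem.leg c) = g,
        (ErgDec.Decomposition.mk c.pt gt (ErgDec.PS.dagger (ErgDec.DynSystem.leg c)) h).Ergodic
          c) ∧
    -- every ergodic decomposition reduces to that one, in a unique way
    (∀ {Y : ErgDec.PS C} (g : Y ⟶ D.space), D.LeftInvariant g →
      ∀ (gt : Y ⟶ c.pt) (h : gt ≫ ErgDec.PS.dagger (ErgDec.DynSystem.leg c) = g)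
        (E : ErgDec.Decomposition g), E.Ergodic c →
        ∃! d : E.mid ⟶ c.pt, E.IsReduction
          (ErgDec.Decomposition.mk c.pt gt (ErgDec.PS.dagger (ErgDec.DynSystem.leg c)) h) d) := by
  refine ⟨hc.isErgodic_dagger_leg, ?_, ?_⟩
  · intro Y g hg
    refine ⟨g ≫ ErgDec.DynSystem.leg c,
      ⟨hc.comp_leg_comp_dagger hC hg, hc.isErgodic_dagger_leg⟩, ?_⟩
    rintro t ⟨h, -⟩
    exact hc.eq_comp_leg h
  · intro Y g _ gt h E hE
    -- The only possible reduction; its determinism is exactly the ergodicity of `E.snd`.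
    refine ⟨E.snd ≫ ErgDec.DynSystem.leg c,
      ⟨hE.det, hc.comp_leg_comp_dagger hC hE.leftInvariant, ?_⟩, ?_⟩
    · change E.fst ≫ E.snd ≫ ErgDec.DynSystem.leg c = gt
      rw [← Category.assoc, E.fac, hc.eq_comp_leg h]
    · intro d hd
      exact hc.eq_comp_leg hd.snd_eq
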